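/- **Theorem 5.1.** Let $\mathcal H$ be a non-zero separable complex Hilbert space and let $T$ be a bounded linear operator on $\mathcal H$ that is essentially hyponormal, i.e. the image of $[T^*,T]=T^*T-TT^*$ in the Calkin algebra $\mathcal L(\mathcal H)/\mathcal K(\mathcal H)$ is nonnegative; that is, $T^*T-TT^*=A+K$ for some nonnegative bounded operator $A$ and some compact self-adjoint operator $K$ on $\mathcal H$. Then $T$ has a proper Følner sequence: there is a sequence $(P_n)_{n\in\mathbb N}$ of non-zero finite-rank orthogonal projections on $\mathcal H$ with $P_n\le P_{n+1}$ for all $n$, with $P_nx\to x$ for every $x\in\mathcal H$, and with $$\lim_{n\to\infty}\frac{\|TP_n-P_nT\|_2}{\|P_n\|_2}=0,$$ where $\|\cdot\|_2$ denotes the Hilbert–Schmidt norm. -/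

import Mathlib

open Filter Topology
open scoped ENNReal InnerProductSpace

namespace Foelner

section Definitions

variable {H : Type*} [NormedAddCommGroup H] [InnerProductSpace ℂ H] [CompleteSpace H]

/-- The Hilbert-Schmidt norm `‖A‖₂ = (∑ᵢ ‖A eᵢ‖²)^(1/2)` of a bounded operator, with values in
`[0, ∞]` (it is `∞` when `A` is not Hilbert-Schmidt), computed in some orthonormal basis of `H`.
It does not depend on the basis, see `hsNorm_eq`. -/
noncomputable def hsNorm (A : H →L[ℂ] H) : ℝ≥0∞ :=
  (∑' e : (exists_hilbertBasis ℂ H).choose, ‖A (e : H)‖ₑ ^ 2) ^ (1 / 2 : ℝ)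

/-- Parseval's identity in `[0, ∞]`. -/
theorem parseval {ι : Type*} (b : HilbertBasis ι ℂ H) (x : H) :
    ∑' i, ‖⟪b i, x⟫_ℂ‖ₑ ^ 2 = ‖x‖ₑ ^ 2 := by
  have h := lp.hasSum_norm (p := 2) (by norm_num) (b.repr x)
  simp only [ENNReal.toReal_ofNat, Real.rpow_ofNat, LinearIsometryEquiv.norm_map,
    HilbertBasis.repr_apply_apply] at h
  have h2 := ENNReal.ofReal_tsum_of_nonneg (fun i => sq_nonneg ‖⟪b i, x⟫_ℂ‖) h.summable
  rw [h.tsum_eq] at h2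
  simpa [ENNReal.ofReal_pow] using h2.symm

theorem tsum_sq_eq_adjoint {ι κ : Type*} (b : HilbertBasis ι ℂ H) (c : HilbertBasis κ ℂ H)
    (A : H →L[ℂ] H) : ∑' i, ‖A (b i)‖ₑ ^ 2 = ∑' k, ‖(star A) (c k)‖ₑ ^ 2 := by
  simp_rw [← parseval c (A _), ← parseval b (star A _)]
  rw [ENNReal.tsum_comm]
  refine tsum_congr fun k => tsum_congr fun i => ?_
  rw [ContinuousLinearMap.star_eq_adjoint, ContinuousLinearMap.adjoint_inner_right,
    ← inner_conj_symm, RCLike.enorm_conj]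

/-- The Hilbert-Schmidt norm may be computed in any orthonormal basis. -/
theorem hsNorm_eq {ι : Type*} (b : HilbertBasis ι ℂ H) (A : H →L[ℂ] H) :
    hsNorm A = (∑' i, ‖A (b i)‖ₑ ^ 2) ^ (1 / 2 : ℝ) := by
  obtain ⟨c, hc⟩ := (exists_hilbertBasis ℂ H).choose_spec
  have h : (∑' e : (exists_hilbertBasis ℂ H).choose, ‖A (e : H)‖ₑ ^ 2)
      = ∑' e, ‖A (c e)‖ₑ ^ 2 := by rw [hc]
  rw [hsNorm, h, tsum_sq_eq_adjoint c b, ← tsum_sq_eq_adjoint b b]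

/-- `P` is a non-zero orthogonal projection of finite rank. -/
structure IsFiniteRankProj (P : H →L[ℂ] H) : Prop where
  isStarProjection : IsStarProjection P
  finite_range : FiniteDimensional ℂ P.range
  ne_zero : P ≠ 0

/-- A Følner sequence for a set `𝒯` of bounded operators: non-zero orthogonal projections `P n` of
finite rank with `‖T P n - P n T‖₂ / ‖P n‖₂ → 0` for every `T ∈ 𝒯`. -/
structure IsFolnerSeq (𝒯 : Set (H →L[ℂ] H)) (P : ℕ → H →L[ℂ] H) : Prop where
  proj : ∀ n, IsFiniteRankProj (P n)
  tendsto_zero : ∀ T ∈ 𝒯, Tendsto (fun n => hsNorm (T * P n - P n * T) / hsNorm (P n)) atTop (𝓝 0)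

/-- A proper Følner sequence: one that is increasing (in the order of self-adjoint operators, i.e.
the ranges increase) and converges strongly to the identity. -/
structure IsProperFolnerSeq (𝒯 : Set (H →L[ℂ] H)) (P : ℕ → H →L[ℂ] H) : Prop
    extends IsFolnerSeq 𝒯 P where
  monotone : Monotone P
  tendsto_id : ∀ x, Tendsto (fun n => P n x) atTop (𝓝 x)

/-- `T` is essentially hyponormal: the self-commutator `[T*, T]` is nonnegative modulo the compact
operators, i.e. it is the sum of a nonnegative operator and a compact self-adjoint one. -/
def IsEssentiallyHyponormal (T : H →L[ℂ] H) : Prop :=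
  ∃ A K : H →L[ℂ] H, A.IsPositive ∧ IsCompactOperator K ∧ IsSelfAdjoint K ∧
    star T * T - T * star T = A + K

end Definitions

end Foelner

/-! ### Weakly null sequences and the essential norm. -/

namespace Foelner

variable {H : Type*} [NormedAddCommGroup H] [InnerProductSpace ℂ H]

/-! In finite dimension `P n = 1` works. Otherwise the point is a scalar `μ` and a weakly null
sequence of unit vectors `w n` with `(T - μ) w n → 0` and `(T - μ)* w n → 0`.

To find `μ`, let `c` be the essential norm of `T`, attained along weakly null unit vectors `x n`.
Compact operators vanish along such sequences, so there `T` behaves like a hyponormal operator: `‖T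
u‖² ≤ ‖T* T u‖ ‖u‖` and `‖T* T u‖ ≲ ‖T T u‖` force `‖T^k x n‖ → c^k`. When `c > 0`, the vectors `v k
= c⁻ᵏ T^k x n` are nearly unit and are shifted by `T / c`. A sum `∑ z^k v k` over `N` terms with
`|z| = 1` can be chosen of norm about `√N` at least, while `T - c z⁻¹` telescopes it to a bounded
vector: an approximate eigenvector. Compactness of the circle fixes `μ`; essential hyponormality of
`T - μ` handles the adjoint.

Such vectors can be taken orthogonal to any finite-dimensional `V`. Adjoining many of them keeps the
Hilbert-Schmidt norm of the commutator bounded while `‖P‖₂ = √rank` grows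
(`exists_le_hsNorm_commutator_div_le`). Including a dense sequence along the way makes the
projections proper. -/

/-- A bounded sequence converging weakly to zero. -/
def WeaklyNull (y : ℕ → H) : Prop :=
  (∃ M, ∀ n, ‖y n‖ ≤ M) ∧ ∀ z, Tendsto (fun n => ⟪z, y n⟫_ℂ) atTop (𝓝 0)

namespace WeaklyNull

theorem comp {y : ℕ → H} (hy : WeaklyNull y) {φ : ℕ → ℕ} (hφ : StrictMono φ) :
    WeaklyNull (fun n => y (φ n)) :=
  ⟨hy.1.imp fun _ hM _ => hM _, fun z => (hy.2 z).comp hφ.tendsto_atTop⟩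

theorem map [CompleteSpace H] {y : ℕ → H} (hy : WeaklyNull y) (A : H →L[ℂ] H) :
    WeaklyNull (fun n => A (y n)) := by
  obtain ⟨⟨M, hM⟩, h⟩ := hy
  refine ⟨⟨‖A‖ * M, fun n => (A.le_opNorm _).trans (by gcongr; exact hM n)⟩, fun z => ?_⟩
  simpa only [ContinuousLinearMap.adjoint_inner_left] using h (ContinuousLinearMap.adjoint A z)

theorem pow [CompleteSpace H] {y : ℕ → H} (hy : WeaklyNull y) (A : H →L[ℂ] H) (k : ℕ) :
    WeaklyNull (fun n => (A ^ k) (y n)) := hy.map (A ^ k)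

theorem smul {y : ℕ → H} (hy : WeaklyNull y) {a : ℕ → ℂ} {C : ℝ} (ha : ∀ n, ‖a n‖ ≤ C) :
    WeaklyNull (fun n => a n • y n) := by
  obtain ⟨⟨M, hM⟩, h⟩ := hy
  refine ⟨⟨C * M, fun n => ?_⟩, fun z => ?_⟩
  · rw [norm_smul]
    exact mul_le_mul (ha n) (hM n) (norm_nonneg _) ((norm_nonneg _).trans (ha n))
  · simp only [inner_smul_right]
    refine squeeze_zero_norm (a := fun n => C * ‖⟪z, y n⟫_ℂ‖) (fun n => ?_)
      (by simpa using (h z).norm.const_mul C)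
    rw [norm_mul]
    exact mul_le_mul_of_nonneg_right (ha n) (norm_nonneg _)

theorem sum {ι : Type*} (s : Finset ι) {y : ι → ℕ → H} (hy : ∀ i ∈ s, WeaklyNull (y i)) :
    WeaklyNull (fun n => ∑ i ∈ s, y i n) := by
  refine ⟨?_, fun z => ?_⟩
  · choose! M hM using fun i (hi : i ∈ s) => (hy i hi).1
    exact ⟨∑ i ∈ s, M i, fun n => norm_sum_le_of_le s fun i hi => hM i hi n⟩
  · simp only [inner_sum]
    simpa using tendsto_finsetSum s fun i hi => (hy i hi).2 z

/-- The images stay in a compact set, and any cluster point is also a weak limit of a subsequence,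
hence zero. -/
theorem tendsto_of_isCompactOperator [CompleteSpace H] {y : ℕ → H} (hy : WeaklyNull y)
    {K : H →L[ℂ] H} (hK : IsCompactOperator K) : Tendsto (fun n => K (y n)) atTop (𝓝 0) := by
  obtain ⟨M, hM⟩ := hy.1
  refine (hK.isCompact_closure_image_closedBall (f := (K : H →ₗ[ℂ] H))
    M).tendsto_nhds_of_unique_mapClusterPt
    (Eventually.of_forall fun n => subset_closure ⟨y n, by simpa using hM n, rfl⟩) ?_
  intro z _ hz
  obtain ⟨ψ, hψ, hlim⟩ := hz.tendsto_subseq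
  have h1 : Tendsto (fun n => ⟪z, K (y (ψ n))⟫_ℂ) atTop (𝓝 ⟪z, z⟫_ℂ) :=
    tendsto_const_nhds.inner hlim
  simpa using tendsto_nhds_unique h1 (((hy.map K).2 z).comp hψ.tendsto_atTop)

theorem of_starProjection {U : ℕ → Submodule ℂ H} [∀ n, FiniteDimensional ℂ (U n)]
    (hU : ∀ x, Tendsto (fun n => (U n).starProjection x) atTop (𝓝 x)) {y : ℕ → H} {M : ℝ}
    (hM : ∀ n, ‖y n‖ ≤ M) (hy : Tendsto (fun n => (U n).starProjection (y n)) atTop (𝓝 0)) :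
    WeaklyNull y := by
  refine ⟨⟨M, hM⟩, fun z => ?_⟩
  have h1 : Tendsto (fun n => ⟪z, (U n).starProjection (y n)⟫_ℂ) atTop (𝓝 0) := by
    simpa using (tendsto_const_nhds (x := z)).inner hy
  have h2 : Tendsto (fun n => ⟪z - (U n).starProjection z, y n⟫_ℂ) atTop (𝓝 0) := by
    refine squeeze_zero_norm (a := fun n => ‖z - (U n).starProjection z‖ * M) (fun n => ?_) ?_
    · exact (norm_inner_le_norm _ _).trans (by gcongr; exact hM n)
    · simpa using (((tendsto_const_nhds (x := z)).sub (hU z)).norm.mul_const M)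
  have h := h1.add h2
  rw [add_zero] at h
  refine h.congr fun n => ?_
  rw [inner_sub_left, Submodule.inner_starProjection_left_eq_right]
  ring

end WeaklyNull

theorem isCompactOperator_starProjection (U : Submodule ℂ H) [FiniteDimensional ℂ U] :
    IsCompactOperator U.starProjection := by
  have := FiniteDimensional.proper ℂ U
  exact (isCompactOperator_of_locallyCompactSpace_dom U.orthogonalProjectionOnto).clm_comp
    U.subtypeL

theorem starProjection_tendsto_of_denseSeq_mem [TopologicalSpace.SeparableSpace H]
    {U : ℕ → Submodule ℂ H} [∀ n, FiniteDimensional ℂ (U n)] (hU : Monotone U)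
    (hd : ∀ n, TopologicalSpace.denseSeq H n ∈ U n) (x : H) :
    Tendsto (fun n => (U n).starProjection x) atTop (𝓝 x) := by
  refine Submodule.starProjection_tendsto_self U hU x fun y _ => ?_
  refine closure_mono ?_ (TopologicalSpace.denseRange_denseSeq H y)
  rintro _ ⟨n, rfl⟩
  exact Submodule.mem_iSup_of_mem n (hd n)

theorem exists_exhaustion (H : Type*) [NormedAddCommGroup H] [InnerProductSpace ℂ H]
    [TopologicalSpace.SeparableSpace H] :
    ∃ U : ℕ → Submodule ℂ H, ∃ _ : ∀ n, FiniteDimensional ℂ (U n), Monotone U ∧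
      ∀ x, Tendsto (fun n => (U n).starProjection x) atTop (𝓝 x) := by
  have hf : ∀ n, FiniteDimensional ℂ
      (Submodule.span ℂ (TopologicalSpace.denseSeq H '' Set.Iic n)) := fun n =>
    FiniteDimensional.span_of_finite ℂ ((Set.finite_Iic n).image _)
  have hm : Monotone fun n => Submodule.span ℂ (TopologicalSpace.denseSeq H '' Set.Iic n) :=
    fun m n h => Submodule.span_mono (Set.image_mono (Set.Iic_subset_Iic.2 h))
  exact ⟨_, hf, hm, starProjection_tendsto_of_denseSeq_mem hm fun n =>
    Submodule.subset_span ⟨n, Set.mem_Iic.2 le_rfl, rfl⟩⟩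

/-- On the orthogonal complement of a finite-dimensional subspace there is a unit vector almost
attaining the norm of the compression of `T`. -/
theorem exists_unit_mem_orthogonal (hH : ¬ FiniteDimensional ℂ H) (T : H →L[ℂ] H)
    (U : Submodule ℂ H) [FiniteDimensional ℂ U] {ε : ℝ} (hε : 0 < ε) :
    ∃ x ∈ Uᗮ, ‖x‖ = 1 ∧ ‖T * Uᗮ.starProjection‖ - ε < ‖T x‖ := by
  have hU : Uᗮ ≠ ⊥ := by
    rw [Ne, Submodule.orthogonal_eq_bot_iff]
    rintro rfl
    exact hH (LinearEquiv.finiteDimensional (Submodule.topEquiv (R := ℂ) (M := H)))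
  by_contra! h
  obtain ⟨v, hv, hv0⟩ := Submodule.exists_mem_ne_zero_of_ne_bot hU
  have hunit : ∀ w ∈ Uᗮ, ‖T w‖ ≤ (‖T * Uᗮ.starProjection‖ - ε) * ‖w‖ := by
    intro w hw
    rcases eq_or_ne w 0 with rfl | hw0
    · simp
    have h1 := h (((‖w‖⁻¹ : ℝ) : ℂ) • w) (Uᗮ.smul_mem _ hw)
      (by simp [norm_smul, hw0])
    rw [map_smul, norm_smul] at h1
    have : 0 < ‖w‖ := norm_pos_iff.2 hw0
    simp only [Complex.norm_real, norm_inv, norm_norm] at h1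
    rwa [inv_mul_le_iff₀ this, mul_comm] at h1
  -- A negative constant would contradict the bound at the non-zero vector `v`.
  have hpos : 0 ≤ ‖T * Uᗮ.starProjection‖ - ε := by
    by_contra! hneg
    have := (norm_nonneg _).trans (hunit v hv)
    nlinarith [norm_pos_iff.2 hv0]
  have := ContinuousLinearMap.opNorm_le_bound (T * Uᗮ.starProjection) hpos fun z =>
    (hunit _ (Submodule.starProjection_apply_mem _ z)).trans
      (mul_le_mul_of_nonneg_left (Submodule.norm_starProjection_apply_le _ z) hpos)
  linarith

/-- A weakly null sequence of unit vectors realizing the essential norm of `T`. -/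
theorem exists_weaklyNull_essNorm [CompleteSpace H] [TopologicalSpace.SeparableSpace H]
    (hH : ¬ FiniteDimensional ℂ H) (T : H →L[ℂ] H) :
    ∃ c : ℝ, 0 ≤ c ∧ (∃ x : ℕ → H, WeaklyNull x ∧ (∀ n, ‖x n‖ = 1) ∧
        Tendsto (fun n => ‖T (x n)‖) atTop (𝓝 c)) ∧
      ∀ (y : ℕ → H) (a : ℝ), WeaklyNull y → Tendsto (fun n => ‖y n‖) atTop (𝓝 a) →
        ∀ ε > 0, ∀ᶠ n in atTop, ‖T (y n)‖ < c * a + ε := by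
  obtain ⟨U, hfin, hmono, hU⟩ := exists_exhaustion H
  set b : ℕ → ℝ := fun n => ‖T * (U n)ᗮ.starProjection‖ with hb
  have hTx : ∀ n, ∀ x ∈ (U n)ᗮ, ‖T x‖ ≤ b n * ‖x‖ := fun n x hx => by
    have := (T * (U n)ᗮ.starProjection).le_opNorm x
    rwa [mul_apply_eq_comp, Submodule.starProjection_eq_self_iff.2 hx] at this
  have hanti : Antitone b := fun m n hmn => by
    refine ContinuousLinearMap.opNorm_le_bound _ (norm_nonneg _) fun z => ?_
    refine (hTx m _ (Submodule.orthogonal_le (hmono hmn)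
      (Submodule.starProjection_apply_mem _ z))).trans ?_
    exact mul_le_mul_of_nonneg_left (Submodule.norm_starProjection_apply_le _ z) (norm_nonneg _)
  have hbdd : BddBelow (Set.range b) := ⟨0, by rintro _ ⟨n, rfl⟩; exact norm_nonneg _⟩
  have hlim : Tendsto b atTop (𝓝 (⨅ n, b n)) := tendsto_atTop_ciInf hanti hbdd
  refine ⟨⨅ n, b n, Real.iInf_nonneg fun n => norm_nonneg _, ?_, ?_⟩
  · choose x hx hx1 hxT using fun n => exists_unit_mem_orthogonal hH T (U n)
      (Nat.one_div_pos_of_nat (α := ℝ) (n := n))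
    refine ⟨x, WeaklyNull.of_starProjection hU (fun n => (hx1 n).le) ?_, hx1, ?_⟩
    · simp only [(Submodule.starProjection_apply_eq_zero_iff _).2 (hx _)]
      exact tendsto_const_nhds
    · refine tendsto_of_tendsto_of_tendsto_of_le_of_le ?_ hlim (fun n => (hxT n).le)
        fun n => by simpa [hx1] using hTx n _ (hx n)
      simpa using hlim.sub (tendsto_one_div_add_atTop_nhds_zero_nat (𝕜 := ℝ))
  · intro y a hy ha ε hε
    -- Fix `m` with `b m * a` close to the limit; the component of `y n` in the fixed space `U m`
    -- then tends to zero in norm.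
    have h1 : Tendsto (fun m => b m * a) atTop (𝓝 ((⨅ n, b n) * a)) := hlim.mul_const a
    obtain ⟨m, hm⟩ := (h1.eventually_lt_const (lt_add_of_pos_right _ hε)).exists
    have h2 : Tendsto (fun n => b m * ‖y n‖ + ‖T‖ * ‖(U m).starProjection (y n)‖) atTop
        (𝓝 (b m * a)) := by
      simpa using (ha.const_mul (b m)).add
        ((hy.tendsto_of_isCompactOperator
          (isCompactOperator_starProjection (U m))).norm.const_mul ‖T‖)
    filter_upwards [h2.eventually_lt_const hm] with n hn
    refine lt_of_le_of_lt ?_ hn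
    have h3 : T (y n) = T ((U m)ᗮ.starProjection (y n)) + T ((U m).starProjection (y n)) := by
      rw [← map_add, add_comm, Submodule.starProjection_add_starProjection_orthogonal]
    rw [h3]
    refine (norm_add_le _ _).trans (add_le_add ?_ (T.le_opNorm _))
    exact (hTx m _ (Submodule.starProjection_apply_mem _ _)).trans
      (mul_le_mul_of_nonneg_left (Submodule.norm_starProjection_apply_le _ _) (norm_nonneg _))

end Foelner

/-! ### Finite Fourier transform and telescoping sums. -/

namespace Foelner

variable {H : Type*} [NormedAddCommGroup H] [InnerProductSpace ℂ H]

/-- Parseval's identity for the finite Fourier transform of a vector-valued sequence. -/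
theorem sum_norm_sq_dft {N : ℕ} {ω : ℂ} (hω : IsPrimitiveRoot ω N) (hN : 0 < N) (v : ℕ → H) :
    ∑ j ∈ Finset.range N, ‖∑ k ∈ Finset.range N, (ω ^ j) ^ k • v k‖ ^ 2
      = N * ∑ k ∈ Finset.range N, ‖v k‖ ^ 2 := by
  have hω1 : ‖ω‖ = 1 := hω.norm'_eq_one hN.ne'
  have hconj : (starRingEnd ℂ) ω = ω⁻¹ := (Complex.inv_eq_conj hω1).symm
  have hω0 : ω ≠ 0 := hω.ne_zero hN.ne'
  have key : ∀ k ∈ Finset.range N, ∀ l ∈ Finset.range N,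
      ∑ j ∈ Finset.range N, (starRingEnd ℂ) ((ω ^ j) ^ k) * (ω ^ j) ^ l
        = if k = l then (N : ℂ) else 0 := by
    intro k hk l hl
    have h1 : ∀ j, (starRingEnd ℂ) ((ω ^ j) ^ k) * (ω ^ j) ^ l = ((ω ^ k)⁻¹ * ω ^ l) ^ j := by
      intro j
      simp only [map_pow, hconj, mul_pow, inv_pow, ← pow_mul, mul_comm]
    simp only [h1]
    split_ifs with hkl
    · subst hkl
      simp [inv_mul_cancel₀ (pow_ne_zero k hω0)]
    · have hne : (ω ^ k)⁻¹ * ω ^ l ≠ 1 := by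
        intro h
        rw [inv_mul_eq_one₀ (pow_ne_zero k hω0)] at h
        exact hkl (hω.pow_inj (Finset.mem_range.1 hk) (Finset.mem_range.1 hl) h)
      rw [geom_sum_eq hne, mul_pow, inv_pow, ← pow_mul, ← pow_mul, mul_comm k, mul_comm l,
        pow_mul, pow_mul, hω.pow_eq_one]
      simp
  have h2 : ∀ w : H, ((‖w‖ ^ 2 : ℝ) : ℂ) = ⟪w, w⟫_ℂ := fun w => by
    rw [inner_self_eq_norm_sq_to_K]; simp
  apply Complex.ofReal_injective
  rw [Complex.ofReal_sum, Complex.ofReal_mul, Complex.ofReal_sum]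
  simp only [h2, Complex.ofReal_natCast]
  simp only [sum_inner, inner_sum, inner_smul_left, inner_smul_right]
  rw [Finset.sum_comm, Finset.mul_sum]
  refine Finset.sum_congr rfl fun k hk => ?_
  simp only [Finset.mul_sum]
  rw [Finset.sum_comm]
  have h3 : ∀ l ∈ Finset.range N, ∑ j ∈ Finset.range N,
      (ω ^ j) ^ k * ((starRingEnd ℂ) ((ω ^ j) ^ l) * ⟪v l, v k⟫_ℂ)
        = (if l = k then (N : ℂ) else 0) * ⟪v l, v k⟫_ℂ := fun l hl => by
    rw [← key l hl k hk, Finset.sum_mul]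
    exact Finset.sum_congr rfl fun j _ => by ring
  rw [Finset.sum_congr rfl h3]
  simp [Finset.mem_range.1 hk]

/-- By Parseval the average over the `N`-th roots of unity equals the left side, so some root does
at least as well. -/
theorem exists_norm_one_sum_norm_sq_le (N : ℕ) (v : ℕ → H) :
    ∃ z : ℂ, ‖z‖ = 1 ∧
      ∑ k ∈ Finset.range N, ‖v k‖ ^ 2 ≤ ‖∑ k ∈ Finset.range N, z ^ k • v k‖ ^ 2 := by
  rcases N.eq_zero_or_pos with rfl | hN
  · exact ⟨1, by simp⟩
  have hω := Complex.isPrimitiveRoot_exp N hN.ne'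
  have h := sum_norm_sq_dft hω hN v
  obtain ⟨j, _, hj⟩ := Finset.exists_le_of_sum_le (s := Finset.range N)
    (f := fun _ => ∑ k ∈ Finset.range N, ‖v k‖ ^ 2) ⟨0, Finset.mem_range.2 hN⟩
    (by rw [h]; simp)
  exact ⟨_, by rw [norm_pow, hω.norm'_eq_one hN.ne', one_pow], hj⟩

theorem apply_geometric_sum {T : H →L[ℂ] H} {v : ℕ → H} {c z : ℂ}
    (hv : ∀ k, T (v k) = c • v (k + 1)) (hz : z ≠ 0)
    (N : ℕ) : (T - (c * z⁻¹) • 1) (∑ k ∈ Finset.range N, z ^ k • v k)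
      = (c * z⁻¹) • (z ^ N • v N - v 0) := by
  have h := Finset.sum_range_sub (fun k => z ^ k • v k) N
  rw [pow_zero, one_smul] at h
  rw [← h, map_sum, Finset.smul_sum]
  refine Finset.sum_congr rfl fun k _ => ?_
  simp only [sub_apply, smul_apply, one_apply_eq_self, map_smul, hv, smul_sub, smul_smul]
  congr 2
  · field_simp
    ring
  · ring

variable [CompleteSpace H]

/-! ### Approximate joint eigenvectors of essentially hyponormal operators. -/

section Hyponormal

variable {T A K : H →L[ℂ] H}

theorem norm_star_apply_sq_le (hA : A.IsPositive) (h : star T * T - T * star T = A + K) (y : H) :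
    ‖(star T) y‖ ^ 2 ≤ ‖T y‖ ^ 2 + ‖K y‖ * ‖y‖ := by
  have h1 := congrArg (fun S : H →L[ℂ] H => (⟪S y, y⟫_ℂ).re) h
  simp only [sub_apply, mul_apply_eq_comp,
    add_apply, inner_sub_left, inner_add_left, Complex.sub_re,
    Complex.add_re] at h1
  have h2 : (⟪(star T) (T y), y⟫_ℂ).re = ‖T y‖ ^ 2 := by
    rw [ContinuousLinearMap.star_eq_adjoint, ContinuousLinearMap.adjoint_inner_left]
    exact (norm_sq_eq_re_inner (𝕜 := ℂ) _).symm
  have h3 : (⟪T ((star T) y), y⟫_ℂ).re = ‖(star T) y‖ ^ 2 := by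
    rw [ContinuousLinearMap.star_eq_adjoint, ← ContinuousLinearMap.adjoint_inner_right]
    exact (norm_sq_eq_re_inner (𝕜 := ℂ) _).symm
  have h4 : 0 ≤ (⟪A y, y⟫_ℂ).re := hA.re_inner_nonneg_left y
  have h5 : -(‖K y‖ * ‖y‖) ≤ (⟪K y, y⟫_ℂ).re :=
    neg_le_of_abs_le ((Complex.abs_re_le_norm _).trans (norm_inner_le_norm _ _))
  linarith

theorem tendsto_star_apply (hA : A.IsPositive) (hK : IsCompactOperator K)
    (h : star T * T - T * star T = A + K) {w : ℕ → H} (hw : WeaklyNull w)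
    (hTw : Tendsto (fun n => T (w n)) atTop (𝓝 0)) :
    Tendsto (fun n => (star T) (w n)) atTop (𝓝 0) := by
  obtain ⟨M, hM⟩ := hw.1
  have h1 : Tendsto (fun n => ‖T (w n)‖ ^ 2 + ‖K (w n)‖ * M) atTop (𝓝 0) := by
    simpa using (hTw.norm.pow 2).add ((hw.tendsto_of_isCompactOperator hK).norm.mul_const M)
  have h2 : Tendsto (fun n => ‖(star T) (w n)‖ ^ 2) atTop (𝓝 0) :=
    squeeze_zero (fun n => sq_nonneg _) (fun n => (norm_star_apply_sq_le hA h (w n)).trans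
      (by gcongr; exact hM n)) h1
  rw [tendsto_zero_iff_norm_tendsto_zero]
  simpa using h2.sqrt

/-- If `u` is weakly null and `T` asymptotically attains its essential norm `c` along `u`, then it
does so along `T u`. -/
theorem tendsto_norm_apply_apply (hA : A.IsPositive) (hK : IsCompactOperator K)
    (h : star T * T - T * star T = A + K) {c : ℝ} (hc : 0 ≤ c)
    (hess : ∀ (y : ℕ → H) (a : ℝ), WeaklyNull y → Tendsto (fun n => ‖y n‖) atTop (𝓝 a) →
      ∀ ε > 0, ∀ᶠ n in atTop, ‖T (y n)‖ < c * a + ε)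
    {u : ℕ → H} (hu : WeaklyNull u) {a : ℝ} (ha : 0 < a)
    (hua : Tendsto (fun n => ‖u n‖) atTop (𝓝 a))
    (hTu : Tendsto (fun n => ‖T (u n)‖) atTop (𝓝 (c * a))) :
    Tendsto (fun n => ‖T (T (u n))‖) atTop (𝓝 (c * (c * a))) := by
  have hw := hu.map T
  -- Lower bound from `‖T u‖² = ⟪T* T u, u⟫` and the hyponormality inequality at `T u`; the upper
  -- bound is `hess`.
  have hlow : Tendsto (fun n => √((‖T (u n)‖ ^ 2 / ‖u n‖) ^ 2 - ‖K (T (u n))‖ * ‖T (u n)‖)) atTop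
      (𝓝 (c * (c * a))) := by
    have h1 := ((((hTu.pow 2).div hua ha.ne').pow 2).sub
      ((hw.tendsto_of_isCompactOperator hK).norm.mul hTu)).sqrt
    have h2 : √(((c * a) ^ 2 / a) ^ 2 - ‖(0 : H)‖ * (c * a)) = c * (c * a) := by
      rw [norm_zero, zero_mul, sub_zero, Real.sqrt_sq (by positivity)]
      field_simp
    rw [h2] at h1
    exact h1
  have hle : ∀ᶠ n in atTop,
      √((‖T (u n)‖ ^ 2 / ‖u n‖) ^ 2 - ‖K (T (u n))‖ * ‖T (u n)‖) ≤ ‖T (T (u n))‖ := by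
    filter_upwards [hua.eventually_const_lt ha] with n hn
    refine Real.sqrt_le_iff.2 ⟨norm_nonneg _, ?_⟩
    have h1 := norm_star_apply_sq_le hA h (T (u n))
    have h2 : ‖T (u n)‖ ^ 2 / ‖u n‖ ≤ ‖(star T) (T (u n))‖ := by
      rw [div_le_iff₀ hn]
      calc ‖T (u n)‖ ^ 2 = (⟪(star T) (T (u n)), u n⟫_ℂ).re := by
            rw [ContinuousLinearMap.star_eq_adjoint, ContinuousLinearMap.adjoint_inner_left]
            exact norm_sq_eq_re_inner (𝕜 := ℂ) _
        _ ≤ _ := (Complex.re_le_norm _).trans (norm_inner_le_norm _ _)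
    have h3 : (‖T (u n)‖ ^ 2 / ‖u n‖) ^ 2 ≤ ‖(star T) (T (u n))‖ ^ 2 := by gcongr
    linarith
  refine tendsto_order.2 ⟨fun b hb => ?_, fun b hb => ?_⟩
  · filter_upwards [hle, hlow.eventually_const_lt hb] with n h1 h2 using h2.trans_le h1
  · filter_upwards [hess _ _ hw hTu _ (sub_pos.2 hb)] with n hn
    linarith

theorem tendsto_norm_pow_apply (hA : A.IsPositive) (hK : IsCompactOperator K)
    (h : star T * T - T * star T = A + K) {c : ℝ} (hc : 0 < c)
    (hess : ∀ (y : ℕ → H) (a : ℝ), WeaklyNull y → Tendsto (fun n => ‖y n‖) atTop (𝓝 a) →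
      ∀ ε > 0, ∀ᶠ n in atTop, ‖T (y n)‖ < c * a + ε)
    {x : ℕ → H} (hx : WeaklyNull x) (hx1 : ∀ n, ‖x n‖ = 1)
    (hTx : Tendsto (fun n => ‖T (x n)‖) atTop (𝓝 c)) (k : ℕ) :
    Tendsto (fun n => ‖(T ^ k) (x n)‖) atTop (𝓝 (c ^ k)) := by
  -- The inductive step uses two consecutive powers.
  suffices Tendsto (fun n => ‖(T ^ k) (x n)‖) atTop (𝓝 (c ^ k)) ∧
      Tendsto (fun n => ‖(T ^ (k + 1)) (x n)‖) atTop (𝓝 (c ^ (k + 1))) from this.1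
  induction k with
  | zero => simpa [hx1] using hTx
  | succ k ih =>
    refine ⟨ih.2, ?_⟩
    have h1 := tendsto_norm_apply_apply hA hK h hc.le hess (hx.pow T k) (pow_pos hc k) ih.1
      (by simpa only [pow_succ', mul_apply_eq_comp] using ih.2)
    simpa only [pow_succ', mul_apply_eq_comp] using h1

/-- Lets the same `A` and `K` serve for every translate of `T`. -/
theorem sub_smul_one_self_commutator (T : H →L[ℂ] H) (μ : ℂ) :
    star (T - μ • 1) * (T - μ • 1) - (T - μ • 1) * star (T - μ • 1)
      = star T * T - T * star T := by
  rw [star_sub, star_smul, star_one]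
  simp only [sub_mul, mul_sub, smul_mul_assoc, mul_smul_comm, one_mul, mul_one,
    smul_sub]
  rw [smul_comm μ (star μ)]
  abel

theorem exists_unit_approx_eigenvector (hA : A.IsPositive) (hK : IsCompactOperator K)
    (h : star T * T - T * star T = A + K) {c : ℝ} (hc : 0 < c)
    (hess : ∀ (y : ℕ → H) (a : ℝ), WeaklyNull y → Tendsto (fun n => ‖y n‖) atTop (𝓝 a) →
      ∀ ε > 0, ∀ᶠ n in atTop, ‖T (y n)‖ < c * a + ε)
    {x : ℕ → H} (hx : WeaklyNull x) (hx1 : ∀ n, ‖x n‖ = 1)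
    (hTx : Tendsto (fun n => ‖T (x n)‖) atTop (𝓝 c)) (U : Submodule ℂ H) [FiniteDimensional ℂ U]
    (N : ℕ) :
    ∃ (w : H) (μ : ℂ), ‖w‖ = 1 ∧ ‖μ‖ = c ∧ ‖U.starProjection w‖ ≤ 1 / ((N : ℝ) + 1) ∧
      ‖(T - μ • 1) w‖ ≤ 6 * c / √((N : ℝ) + 1) := by
  have hc0 : (c : ℂ) ≠ 0 := by exact_mod_cast hc.ne'
  set v : ℕ → ℕ → H := fun n k => ((c : ℂ)⁻¹) ^ k • (T ^ k) (x n) with hv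
  have hTv : ∀ n k, T (v n k) = (c : ℂ) • v n (k + 1) := fun n k => by
    simp only [hv, map_smul, smul_smul, pow_succ', mul_apply_eq_comp]
    rw [mul_inv_cancel_left₀ hc0]
  have hv0 : ∀ n, ‖v n 0‖ = 1 := fun n => by simp [hv, hx1]
  have hnorm : ∀ k, Tendsto (fun n => ‖v n k‖) atTop (𝓝 1) := fun k => by
    have h1 := (tendsto_norm_pow_apply hA hK h hc hess hx hx1 hTx k).const_mul ((c⁻¹) ^ k)
    rw [inv_pow, inv_mul_cancel₀ (pow_ne_zero k hc.ne')] at h1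
    refine h1.congr fun n => ?_
    simp [hv, norm_smul, abs_of_pos hc]
  choose z hz1 hz using fun n => exists_norm_one_sum_norm_sq_le (N + 1) (v n)
  set y : ℕ → H := fun n => ∑ k ∈ Finset.range (N + 1), z n ^ k • v n k with hy
  have hvw : ∀ k, WeaklyNull (fun n => v n k) := fun k =>
    (hx.pow T k).smul (a := fun _ => ((c : ℂ)⁻¹) ^ k) fun _ => le_rfl
  have hyw : WeaklyNull y := WeaklyNull.sum _ fun k _ =>
    (hvw k).smul (C := 1) fun n => by rw [norm_pow, hz1, one_pow]
  have hN : (1 : ℝ) ≤ (N : ℝ) + 1 := by simp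
  have hs1 : 1 ≤ √((N : ℝ) + 1) := Real.one_le_sqrt.2 hN
  -- The sum tends to `N + 1`; a quarter of it suffices for `‖y n‖ ≥ √(N + 1) / 2`.
  have e1 : ∀ᶠ n in atTop, ((N : ℝ) + 1) / 4 < ∑ k ∈ Finset.range (N + 1), ‖v n k‖ ^ 2 := by
    have h1 : Tendsto (fun n => ∑ k ∈ Finset.range (N + 1), ‖v n k‖ ^ 2) atTop
        (𝓝 ((N : ℝ) + 1)) := by
      simpa using tendsto_finsetSum (Finset.range (N + 1)) fun k _ => (hnorm k).pow 2
    exact h1.eventually_const_lt (by linarith)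
  have e2 : ∀ᶠ n in atTop, ‖v n (N + 1)‖ < 2 := (hnorm _).eventually_lt_const (by norm_num)
  have e3 : ∀ᶠ n in atTop, ‖U.starProjection (y n)‖ < 1 / (2 * ((N : ℝ) + 1)) := by
    have h1 := (hyw.tendsto_of_isCompactOperator (isCompactOperator_starProjection U)).norm
    rw [norm_zero] at h1
    exact h1.eventually_lt_const (by positivity)
  obtain ⟨n, h1, h2, h3⟩ := (e1.and (e2.and e3)).exists
  have hyn : √((N : ℝ) + 1) / 2 ≤ ‖y n‖ := by
    have : √((N : ℝ) + 1) / 2 = √(((N : ℝ) + 1) / 4) := by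
      rw [Real.sqrt_div (by positivity)]
      congr 1
      rw [show (4 : ℝ) = 2 ^ 2 by norm_num, Real.sqrt_sq (by norm_num)]
    rw [this]
    exact Real.sqrt_le_iff.2 ⟨norm_nonneg _, (h1.trans_le (hz n)).le⟩
  have hypos : 0 < ‖y n‖ := by linarith
  have hz0 : z n ≠ 0 := norm_pos_iff.1 (by rw [hz1]; exact one_pos)
  have hinv : ‖((‖y n‖⁻¹ : ℝ) : ℂ)‖ = ‖y n‖⁻¹ := by simp
  refine ⟨((‖y n‖⁻¹ : ℝ) : ℂ) • y n, c * (z n)⁻¹, ?_, ?_, ?_, ?_⟩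
  · rw [norm_smul, hinv, inv_mul_cancel₀ hypos.ne']
  · simp [hz1, abs_of_pos hc]
  · rw [map_smul, norm_smul, hinv, inv_mul_le_iff₀ hypos]
    refine h3.le.trans ?_
    rw [one_div, mul_inv, one_div]
    refine mul_le_mul_of_nonneg_right ?_ (by positivity)
    linarith
  · rw [map_smul, norm_smul, hinv, inv_mul_le_iff₀ hypos, apply_geometric_sum (hTv n) hz0,
      norm_smul]
    -- Only the two ends of the telescoping sum remain; `3` over `√(N + 1) / 2` gives the constant
    -- `6`.
    have h4 : ‖z n ^ (N + 1) • v n (N + 1) - v n 0‖ ≤ 3 := by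
      refine (norm_sub_le _ _).trans ?_
      rw [norm_smul, norm_pow, hz1, one_pow, one_mul, hv0]
      linarith
    have h5 : ‖(c : ℂ) * (z n)⁻¹‖ = c := by simp [hz1, abs_of_pos hc]
    rw [h5]
    calc c * _ ≤ c * 3 := by gcongr
      _ = √((N : ℝ) + 1) / 2 * (6 * c / √((N : ℝ) + 1)) := by field_simp; norm_num
      _ ≤ _ := by gcongr

/-- An essentially hyponormal operator on an infinite-dimensional space has a weakly null sequence
of unit vectors which are asymptotically joint eigenvectors of the operator and its adjoint. -/
theorem exists_weaklyNull_joint_eigenvectors [TopologicalSpace.SeparableSpace H]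
    (hH : ¬ FiniteDimensional ℂ H) (hT : IsEssentiallyHyponormal T) :
    ∃ (w : ℕ → H) (μ : ℂ), WeaklyNull w ∧ (∀ n, ‖w n‖ = 1) ∧
      Tendsto (fun n => (T - μ • 1) (w n)) atTop (𝓝 0) ∧
      Tendsto (fun n => (star (T - μ • 1)) (w n)) atTop (𝓝 0) := by
  obtain ⟨A, K, hA, hK, -, h⟩ := hT
  suffices ∃ (w : ℕ → H) (μ : ℂ), WeaklyNull w ∧ (∀ n, ‖w n‖ = 1) ∧
      Tendsto (fun n => (T - μ • 1) (w n)) atTop (𝓝 0) by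
    obtain ⟨w, μ, hw, hw1, hTw⟩ := this
    exact ⟨w, μ, hw, hw1, hTw, tendsto_star_apply hA hK
      ((sub_smul_one_self_commutator T μ).trans h) hw hTw⟩
  obtain ⟨c, hc, ⟨x, hx, hx1, hTx⟩, hess⟩ := exists_weaklyNull_essNorm hH T
  rcases hc.eq_or_lt with rfl | hc
  · exact ⟨x, 0, hx, hx1, by simpa [tendsto_zero_iff_norm_tendsto_zero] using hTx⟩
  obtain ⟨U, hfin, -, hU⟩ := exists_exhaustion H
  choose w μ hw1 hμ hUw hTw using fun N =>
    exists_unit_approx_eigenvector hA hK h hc hess hx hx1 hTx (U N) N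
  have hw : WeaklyNull w := WeaklyNull.of_starProjection hU (fun n => (hw1 n).le)
    (squeeze_zero_norm hUw tendsto_one_div_add_atTop_nhds_zero_nat)
  -- The approximate eigenvalues vary with `N` on a circle; a subsequence converges to a single one.
  obtain ⟨ν, -, φ, hφ, hlim⟩ := (isCompact_sphere (0 : ℂ) c).tendsto_subseq
    (x := μ) fun n => by simp [hμ]
  refine ⟨fun n => w (φ n), ν, hw.comp hφ, fun n => hw1 _, ?_⟩
  have h1 : Tendsto (fun n : ℕ => 6 * c / √((n : ℝ) + 1)) atTop (𝓝 0) :=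
    (Real.tendsto_sqrt_atTop.comp
      (tendsto_natCast_atTop_atTop.atTop_add (tendsto_const_nhds (x := (1 : ℝ))))).const_div_atTop _
  have h2 : Tendsto (fun n => 6 * c / √((φ n : ℝ) + 1) + ‖μ (φ n) - ν‖) atTop (𝓝 0) := by
    simpa using (h1.comp hφ.tendsto_atTop).add (hlim.sub_const ν).norm
  refine squeeze_zero_norm (fun n => ?_) h2
  have h3 : (T - ν • 1) (w (φ n)) = (T - μ (φ n) • 1) (w (φ n)) + (μ (φ n) - ν) • w (φ n) := by
    simp only [sub_apply, smul_apply, one_apply_eq_self, sub_smul]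
    abel
  rw [h3]
  refine (norm_add_le _ _).trans (add_le_add (hTw _) ?_)
  rw [norm_smul, hw1, mul_one]

/-- Joint approximate eigenvectors can be found orthogonal to any finite-dimensional subspace. -/
theorem exists_unit_joint_eigenvector_mem_orthogonal {w : ℕ → H} {μ : ℂ} (hw : WeaklyNull w)
    (hw1 : ∀ n, ‖w n‖ = 1) (h1 : Tendsto (fun n => (T - μ • 1) (w n)) atTop (𝓝 0))
    (h2 : Tendsto (fun n => (star (T - μ • 1)) (w n)) atTop (𝓝 0))
    (U : Submodule ℂ H) [FiniteDimensional ℂ U] {ε : ℝ} (hε : 0 < ε) :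
    ∃ f ∈ Uᗮ, ‖f‖ = 1 ∧ ‖(T - μ • 1) f‖ ≤ ε ∧ ‖(star (T - μ • 1)) f‖ ≤ ε := by
  have hP := hw.tendsto_of_isCompactOperator (isCompactOperator_starProjection U)
  have key : ∀ S : H →L[ℂ] H, Tendsto (fun n => S (w n)) atTop (𝓝 0) →
      ∀ᶠ n in atTop, ‖S (w n - U.starProjection (w n))‖ < ε / 2 := fun S hS => by
    have h3 : Tendsto (fun n => S (w n - U.starProjection (w n))) atTop (𝓝 0) := by
      simpa using hS.sub ((S.continuous.tendsto 0).comp hP)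
    exact (by simpa using h3.norm : Tendsto _ _ (𝓝 (0 : ℝ))).eventually_lt_const (by positivity)
  have e3 : ∀ᶠ n in atTop, ‖U.starProjection (w n)‖ < 1 / 2 :=
    (by simpa using hP.norm : Tendsto _ _ (𝓝 (0 : ℝ))).eventually_lt_const (by positivity)
  obtain ⟨n, e1, e2, e3⟩ := ((key _ h1).and ((key _ h2).and e3)).exists
  set g := w n - U.starProjection (w n) with hg
  have hgU : g ∈ Uᗮ := Submodule.sub_starProjection_mem_orthogonal _
  -- Normalizing `g` at most doubles norms, which the bounds `ε / 2` absorb.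
  have hgn : 1 / 2 ≤ ‖g‖ := by
    have := norm_sub_norm_le (w n) (U.starProjection (w n))
    rw [hw1] at this
    linarith
  have hpos : 0 < ‖g‖ := by linarith
  have hinv : ‖((‖g‖⁻¹ : ℝ) : ℂ)‖ = ‖g‖⁻¹ := by simp
  refine ⟨((‖g‖⁻¹ : ℝ) : ℂ) • g, Uᗮ.smul_mem _ hgU, ?_, ?_, ?_⟩
  · rw [norm_smul, hinv, inv_mul_cancel₀ hpos.ne']
  all_goals
    rw [map_smul, norm_smul, hinv, inv_mul_le_iff₀ hpos]
    nlinarith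

end Hyponormal

end Foelner

/-! ### Finite-rank projections and Hilbert-Schmidt norms. -/

namespace Foelner

variable {H : Type*} [NormedAddCommGroup H] [InnerProductSpace ℂ H]

theorem starProjection_sup_span_singleton {V : Submodule ℂ H} [FiniteDimensional ℂ V] {f : H}
    (hf : f ∈ Vᗮ) (hf1 : ‖f‖ = 1) :
    (V ⊔ ℂ ∙ f).starProjection = V.starProjection + InnerProductSpace.rankOne ℂ f f := by
  ext x
  refine Submodule.eq_starProjection_of_mem_orthogonal ?_ ?_
  · exact Submodule.add_mem_sup (Submodule.starProjection_apply_mem _ _)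
      (Submodule.smul_mem _ _ (Submodule.mem_span_singleton_self f))
  · rw [← Submodule.inf_orthogonal, Submodule.mem_inf,
      Submodule.mem_orthogonal_singleton_iff_inner_right]
    simp only [add_apply, InnerProductSpace.rankOne_apply]
    constructor
    · rw [← sub_sub]
      exact Submodule.sub_mem _ (Submodule.sub_starProjection_mem_orthogonal _)
        (Submodule.smul_mem _ _ hf)
    · have h1 : ⟪f, V.starProjection x⟫_ℂ = 0 :=
        Submodule.inner_left_of_mem_orthogonal (Submodule.starProjection_apply_mem _ _) hf
      simp [inner_sub_right, inner_add_right, inner_smul_right, h1, hf1]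

theorem finrank_lt_finrank_sup_span_singleton {V : Submodule ℂ H} [FiniteDimensional ℂ V] {f : H}
    (hf : f ∈ Vᗮ) (hf1 : ‖f‖ = 1) :
    Module.finrank ℂ V < Module.finrank ℂ ↥(V ⊔ ℂ ∙ f) := by
  refine Submodule.finrank_lt_finrank_of_lt (lt_of_le_of_ne le_sup_left fun h => ?_)
  have hfV : f ∈ V := h ▸ Submodule.mem_sup_right (Submodule.mem_span_singleton_self f)
  have h0 : f = 0 := inner_self_eq_zero.1 (Submodule.inner_right_of_mem_orthogonal hfV hf)
  simp [h0] at hf1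

variable [CompleteSpace H]

section HilbertSchmidt

theorem hsNorm_zero : hsNorm (0 : H →L[ℂ] H) = 0 := by
  simp [hsNorm]

theorem hsNorm_neg (A : H →L[ℂ] H) : hsNorm (-A) = hsNorm A := by
  simp [hsNorm]

theorem hsNorm_add_le (A B : H →L[ℂ] H) : hsNorm (A + B) ≤ hsNorm A + hsNorm B := by
  have key : ∀ (C : H →L[ℂ] H) (s : Finset (exists_hilbertBasis ℂ H).choose),
      (∑ e ∈ s, ‖C (e : H)‖ₑ ^ (2 : ℝ)) ^ (1 / 2 : ℝ) ≤ hsNorm C := fun C s => by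
    simp only [ENNReal.rpow_two, hsNorm]
    exact ENNReal.rpow_le_rpow (ENNReal.sum_le_tsum s) (by norm_num)
  rw [hsNorm, one_div, ENNReal.rpow_inv_le_iff (by norm_num), ENNReal.tsum_eq_iSup_sum]
  refine iSup_le fun s => ?_
  rw [← ENNReal.rpow_inv_le_iff (by norm_num), ← one_div]
  refine le_trans ?_ ((ENNReal.Lp_add_le s (fun e => ‖A (e : H)‖ₑ) (fun e => ‖B (e : H)‖ₑ)
    (one_le_two : (1 : ℝ) ≤ 2)).trans (add_le_add (key A s) (key B s)))
  refine ENNReal.rpow_le_rpow (Finset.sum_le_sum fun e _ => ?_) (by norm_num)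
  rw [ENNReal.rpow_two]
  gcongr
  exact enorm_add_le _ _

theorem hsNorm_sub_le (A B : H →L[ℂ] H) : hsNorm (A - B) ≤ hsNorm A + hsNorm B := by
  rw [sub_eq_add_neg, ← hsNorm_neg B]
  exact hsNorm_add_le A (-B)

theorem hsNorm_sum_ne_top {ι : Type*} (s : Finset ι) {A : ι → H →L[ℂ] H}
    (hA : ∀ i ∈ s, hsNorm (A i) ≠ ∞) : hsNorm (∑ i ∈ s, A i) ≠ ∞ := by
  refine Finset.sum_induction A (fun B => hsNorm B ≠ ∞) (fun B C hB hC => ?_) ?_ hA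
  · exact ne_top_of_le_ne_top (ENNReal.add_ne_top.2 ⟨hB, hC⟩) (hsNorm_add_le B C)
  · simp [hsNorm_zero]

theorem hsNorm_rankOne (x y : H) :
    hsNorm (InnerProductSpace.rankOne ℂ x y) = ‖x‖ₑ * ‖y‖ₑ := by
  obtain ⟨s, b, -⟩ := exists_hilbertBasis ℂ H
  have h : ∀ i, ‖InnerProductSpace.rankOne ℂ x y (b i)‖ₑ ^ 2 = ‖⟪b i, y⟫_ℂ‖ₑ ^ 2 * ‖x‖ₑ ^ 2 := by
    intro i
    rw [InnerProductSpace.rankOne_apply, enorm_smul, mul_pow, ← inner_conj_symm, RCLike.enorm_conj]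
  rw [hsNorm_eq b, tsum_congr h, ENNReal.tsum_mul_right, parseval, ← mul_pow, ← ENNReal.rpow_two,
    ← ENNReal.rpow_mul, mul_comm ‖x‖ₑ]
  norm_num

theorem hsNorm_starProjection (V : Submodule ℂ H) [FiniteDimensional ℂ V] :
    hsNorm V.starProjection = ENNReal.ofReal √(Module.finrank ℂ V) := by
  obtain ⟨s, b, -⟩ := exists_hilbertBasis ℂ H
  set e := stdOrthonormalBasis ℂ V
  have h : ∀ i, ‖V.starProjection (b i)‖ₑ ^ 2 = ∑ k, ‖⟪b i, (e k : H)⟫_ℂ‖ₑ ^ 2 := by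
    intro i
    have h1 := e.sum_sq_norm_inner_left (V.orthogonalProjectionOnto (b i))
    have h2 : ∀ k, ⟪V.orthogonalProjectionOnto (b i), e k⟫_ℂ = ⟪b i, (e k : H)⟫_ℂ := fun k => by
      simp
    simp only [h2] at h1
    rw [← ofReal_norm, ← ENNReal.ofReal_pow (norm_nonneg _), Submodule.starProjection_apply,
      Submodule.norm_coe, ← h1, ENNReal.ofReal_sum_of_nonneg fun k _ => sq_nonneg _]
    exact Finset.sum_congr rfl fun k _ => by rw [ENNReal.ofReal_pow (norm_nonneg _), ofReal_norm]
  have h3 : ∑' i, ‖V.starProjection (b i)‖ₑ ^ 2 = Module.finrank ℂ V := by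
    rw [tsum_congr h]
    simp_rw [← tsum_fintype (L := SummationFilter.unconditional _)]
    rw [ENNReal.tsum_comm]
    have h4 : ∀ k, ‖(e k : H)‖ₑ = 1 := fun k => by
      rw [← ofReal_norm, Submodule.norm_coe, e.norm_eq_one]; simp
    simp [parseval, h4]
  rw [hsNorm_eq b, h3, Real.sqrt_eq_rpow,
    ← ENNReal.ofReal_rpow_of_nonneg (by positivity) (by norm_num),
    ENNReal.ofReal_natCast]

/-- Scalars commute with everything, so `T` may be replaced by `T - μ`; the commutator is then small
when `f` is nearly a joint eigenvector. -/
theorem commutator_rankOne_self (T : H →L[ℂ] H) (μ : ℂ) (f : H) :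
    T * InnerProductSpace.rankOne ℂ f f - InnerProductSpace.rankOne ℂ f f * T
      = InnerProductSpace.rankOne ℂ ((T - μ • 1) f) f
        - InnerProductSpace.rankOne ℂ f ((star (T - μ • 1)) f) := by
  rw [ContinuousLinearMap.star_eq_adjoint, ← InnerProductSpace.comp_rankOne,
    ← InnerProductSpace.rankOne_comp]
  change _ = (T - μ • 1) * _ - _ * (T - μ • 1)
  simp only [sub_mul, mul_sub, smul_mul_assoc, mul_smul_comm, one_mul, mul_one]
  abel

theorem hsNorm_commutator_starProjection_ne_top (T : H →L[ℂ] H) (V : Submodule ℂ H)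
    [FiniteDimensional ℂ V] : hsNorm (T * V.starProjection - V.starProjection * T) ≠ ∞ := by
  rw [(stdOrthonormalBasis ℂ V).starProjection_eq_sum_rankOne, Finset.mul_sum, Finset.sum_mul,
    ← Finset.sum_sub_distrib]
  refine hsNorm_sum_ne_top _ fun i _ => ?_
  rw [commutator_rankOne_self T 0]
  refine ne_top_of_le_ne_top ?_ (hsNorm_sub_le _ _)
  rw [hsNorm_rankOne, hsNorm_rankOne]
  finiteness

end HilbertSchmidt

theorem isFiniteRankProj_starProjection {V : Submodule ℂ H} [FiniteDimensional ℂ V] (hV : V ≠ ⊥) :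
    IsFiniteRankProj V.starProjection where
  isStarProjection := isStarProjection_starProjection
  finite_range := by rw [Submodule.range_starProjection]; infer_instance
  ne_zero h := hV (by rw [← Submodule.range_starProjection V, h]; simp)

/-! ### Enlarging subspaces and building the Følner sequence. -/

section Extension

variable {T : H →L[ℂ] H} {μ : ℂ}

/-- Each adjoined unit vector adds two rank-one terms of norm at most `ε` to the commutator. -/
theorem exists_le_hsNorm_commutator_le
    (hT : ∀ (U : Submodule ℂ H) [FiniteDimensional ℂ U], ∀ ε > 0,
      ∃ f ∈ Uᗮ, ‖f‖ = 1 ∧ ‖(T - μ • 1) f‖ ≤ ε ∧ ‖(star (T - μ • 1)) f‖ ≤ ε)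
    (V : Submodule ℂ H) [FiniteDimensional ℂ V] {ε : ℝ} (hε : 0 < ε) (m : ℕ) :
    ∃ (W : Submodule ℂ H) (_ : FiniteDimensional ℂ W), V ≤ W ∧ m ≤ Module.finrank ℂ W ∧
      hsNorm (T * W.starProjection - W.starProjection * T)
        ≤ hsNorm (T * V.starProjection - V.starProjection * T) + ENNReal.ofReal (m * (2 * ε)) := by
  induction m with
  | zero => exact ⟨V, inferInstance, le_rfl, Nat.zero_le _, le_self_add⟩
  | succ m ih =>
    obtain ⟨W, hW, hVW, hm, hle⟩ := ih
    obtain ⟨f, hf, hf1, hf2, hf3⟩ := hT W ε hε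
    refine ⟨W ⊔ ℂ ∙ f, inferInstance, hVW.trans le_sup_left,
      hm.trans_lt (finrank_lt_finrank_sup_span_singleton hf hf1), ?_⟩
    have h1 : T * (W ⊔ ℂ ∙ f).starProjection - (W ⊔ ℂ ∙ f).starProjection * T
        = (T * W.starProjection - W.starProjection * T)
          + (InnerProductSpace.rankOne ℂ ((T - μ • 1) f) f
            - InnerProductSpace.rankOne ℂ f ((star (T - μ • 1)) f)) := by
      rw [← commutator_rankOne_self, starProjection_sup_span_singleton hf hf1, mul_add, add_mul]
      abel
    have h2 : ‖f‖ₑ = 1 := by rw [← ofReal_norm, hf1, ENNReal.ofReal_one]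
    rw [h1]
    refine (hsNorm_add_le _ _).trans ((add_le_add hle (hsNorm_sub_le _ _)).trans ?_)
    rw [hsNorm_rankOne, hsNorm_rankOne, h2, mul_one, one_mul, ← ofReal_norm, ← ofReal_norm,
      add_assoc, ← ENNReal.ofReal_add (norm_nonneg _) (norm_nonneg _),
      ← ENNReal.ofReal_add (by positivity) (by positivity)]
    gcongr
    rw [Nat.cast_succ]
    linarith

theorem exists_le_hsNorm_commutator_div_le
    (hT : ∀ (U : Submodule ℂ H) [FiniteDimensional ℂ U], ∀ ε > 0,
      ∃ f ∈ Uᗮ, ‖f‖ = 1 ∧ ‖(T - μ • 1) f‖ ≤ ε ∧ ‖(star (T - μ • 1)) f‖ ≤ ε)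
    (V : Submodule ℂ H) [FiniteDimensional ℂ V] {δ : ℝ} (hδ : 0 < δ) :
    ∃ (W : Submodule ℂ H) (_ : FiniteDimensional ℂ W), V ≤ W ∧ W ≠ ⊥ ∧
      hsNorm (T * W.starProjection - W.starProjection * T) / hsNorm W.starProjection
        ≤ ENNReal.ofReal δ := by
  set C := hsNorm (T * V.starProjection - V.starProjection * T) with hCdef
  have hC : C ≠ ∞ := hsNorm_commutator_starProjection_ne_top T V
  -- Taking `ε = 1 / (2 m)` makes `m` new vectors cost `1` in total, so `C + 1 ≤ δ √m` is what is
  -- needed; `m ≥ 1` ensures `W ≠ ⊥`.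
  obtain ⟨m, hm⟩ := exists_nat_ge (max 1 (((C.toReal + 1) / δ) ^ 2))
  have hm1 : (1 : ℝ) ≤ m := (le_max_left _ _).trans hm
  have hm0 : (0 : ℝ) < m := one_pos.trans_le hm1
  obtain ⟨W, hW, hVW, hmW, hle⟩ := exists_le_hsNorm_commutator_le hT V
    (ε := 1 / (2 * (m : ℝ))) (by positivity) m
  refine ⟨W, hW, hVW, ?_, ?_⟩
  · rintro rfl
    rw [finrank_bot] at hmW
    have : 1 ≤ m := by exact_mod_cast hm1
    omega
  · refine ENNReal.div_le_of_le_mul (hle.trans ?_)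
    rw [hsNorm_starProjection, ← ENNReal.ofReal_mul hδ.le, ← hCdef, ← ENNReal.ofReal_toReal hC,
      ← ENNReal.ofReal_add ENNReal.toReal_nonneg (by positivity)]
    refine ENNReal.ofReal_le_ofReal ?_
    have h1 : (m : ℝ) * (2 * (1 / (2 * (m : ℝ)))) = 1 := by field_simp
    rw [h1, ← div_le_iff₀' hδ]
    refine Real.le_sqrt_of_sq_le (((le_max_right _ _).trans hm).trans ?_)
    exact_mod_cast hmW

end Extension

theorem exists_isProperFolnerSeq_of_finiteDimensional [Nontrivial H] [FiniteDimensional ℂ H]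
    (T : H →L[ℂ] H) : ∃ P : ℕ → H →L[ℂ] H, IsProperFolnerSeq {T} P := by
  refine ⟨fun _ => 1, ⟨⟨fun _ => ⟨IsStarProjection.one _, inferInstance, one_ne_zero⟩, ?_⟩,
    monotone_const, fun x => tendsto_const_nhds⟩⟩
  rintro S -
  simp [hsNorm_zero]

theorem exists_isProperFolnerSeq_of_forall_exists [TopologicalSpace.SeparableSpace H]
    {T : H →L[ℂ] H}
    (hT : ∀ (V : Submodule ℂ H) [FiniteDimensional ℂ V], ∀ δ > 0,
      ∃ (W : Submodule ℂ H) (_ : FiniteDimensional ℂ W), V ≤ W ∧ W ≠ ⊥ ∧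
        hsNorm (T * W.starProjection - W.starProjection * T) / hsNorm W.starProjection
          ≤ ENNReal.ofReal δ) :
    ∃ P : ℕ → H →L[ℂ] H, IsProperFolnerSeq {T} P := by
  have hstep : ∀ (n : ℕ) (V : {V : Submodule ℂ H // FiniteDimensional ℂ V}),
      ∃ (W : Submodule ℂ H) (_ : FiniteDimensional ℂ W), V.1 ≤ W ∧
        TopologicalSpace.denseSeq H n ∈ W ∧ W ≠ ⊥ ∧
        hsNorm (T * W.starProjection - W.starProjection * T) / hsNorm W.starProjection
          ≤ ENNReal.ofReal (1 / ((n : ℝ) + 1)) := by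
    rintro n ⟨V, hV⟩
    obtain ⟨W, hW, hVW, h1, h2⟩ := hT (V ⊔ ℂ ∙ (TopologicalSpace.denseSeq H n))
      (1 / ((n : ℝ) + 1)) (by positivity)
    exact ⟨W, hW, le_sup_left.trans hVW,
      hVW (Submodule.mem_sup_right (Submodule.mem_span_singleton_self _)), h1, h2⟩
  choose W hW hVW hd hne hle using hstep
  -- `V n` is the space before stage `n`, and `V (n + 1)` is `U n` by definition, so monotonicity is
  -- `hVW` at `n + 1`.
  let V : ℕ → {V : Submodule ℂ H // FiniteDimensional ℂ V} := fun n =>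
    Nat.rec ⟨⊥, inferInstance⟩ (fun k V => ⟨W k V, hW k V⟩) n
  let U : ℕ → Submodule ℂ H := fun n => W n (V n)
  have hU : ∀ n, FiniteDimensional ℂ (U n) := fun n => hW n (V n)
  have hmono : Monotone U := monotone_nat_of_le_succ fun n => hVW (n + 1) (V (n + 1))
  refine ⟨fun n => (U n).starProjection, ⟨⟨fun n => isFiniteRankProj_starProjection (hne n _), ?_⟩,
    fun m n hmn => Submodule.starProjection_le_starProjection_iff.2 (hmono hmn),
    starProjection_tendsto_of_denseSeq_mem hmono fun n => hd n _⟩⟩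
  rintro S rfl
  have h0 : Tendsto (fun n : ℕ => ENNReal.ofReal (1 / ((n : ℝ) + 1))) atTop (𝓝 0) := by
    simpa using ENNReal.tendsto_ofReal tendsto_one_div_add_atTop_nhds_zero_nat
  exact tendsto_of_tendsto_of_tendsto_of_le_of_le tendsto_const_nhds h0 (fun _ => zero_le)
    fun n => hle n (V n)

end Foelner

theorem theorem5p1 {H : Type*} [NormedAddCommGroup H] [InnerProductSpace ℂ H] [CompleteSpace H]
    [TopologicalSpace.SeparableSpace H] [Nontrivial H]
    (T : H →L[ℂ] H) (hT : Foelner.IsEssentiallyHyponormal T) :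
    ∃ P : ℕ → H →L[ℂ] H, Foelner.IsProperFolnerSeq {T} P := by
  by_cases hH : FiniteDimensional ℂ H
  · exact Foelner.exists_isProperFolnerSeq_of_finiteDimensional T
  obtain ⟨w, μ, hw, hw1, h1, h2⟩ := Foelner.exists_weaklyNull_joint_eigenvectors hH hT
  refine Foelner.exists_isProperFolnerSeq_of_forall_exists fun V _ δ hδ => ?_
  exact Foelner.exists_le_hsNorm_commutator_div_le (μ := μ) (fun U _ ε hε =>
    Foelner.exists_unit_joint_eigenvector_mem_orthogonal hw hw1 h1 h2 U hε) V hδ
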